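/- Let $G=(V,E)$ be a finite, simple, connected, $D$-regular graph with at least one edge, let $d$ be its combinatorial distance and $L=\max_{x,y\in V}d(x,y)$ its diameter. For $x\in V$ let $\mu_x$ be the uniform probability measure on the $D+1$ vertices consisting of $x$ and its neighbours, and for probability measures $\mu_1,\mu_2$ on $V$ let $$W_1(\mu_1,\mu_2)=\inf_{\pi}\ \sum_{x\in V}\sum_{y\in V}d(x,y)\,\pi(x,y),$$ where $\pi$ runs over all functions $V\times V\to[0,1]$ with $\sum_{y}\pi(x,y)=\mu_1(x)$ for all $x$ and $\sum_{x}\pi(x,y)=\mu_2(y)$ for all $y$. For $x\ne y$ define the (Ollivier Ricci) curvature $$\kappa(x,y)=\frac{D+1}{D}\left(1-\frac{W_1(\mu_x,\mu_y)}{d(x,y)}\right).$$ The graph $G$ is called $(D,L)$-Bonnet-Myers sharp if $\inf_{x\sim y}\kappa(x,y)>0$ and $\inf_{x\sim y}\kappa(x,y)=\frac{2}{L}$, the infimum being taken over all pairs of adjacent vertices. **Theorem.** If $G$ is $(D,L)$-Bonnet-Myers sharp with $L=D$, then $G$ is isomorphic to the hypercube $Q^D$, that is, to the graph with vertex set $\{0,1\}^D$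 in which two vertices are adjacent if and only if their Hamming distance is one. -/

import Mathlib

namespace BonnetMyers

variable {V : Type*}

/-- The hypercube `Q^n`: its vertices are the elements of `{0,1}^n`, and two of them are adjacent
if and only if their Hamming distance is one. -/
def hypercube (n : ℕ) : SimpleGraph (Fin n → Bool) where
  Adj a b := hammingDist a b = 1
  symm := ⟨fun a b h => by rw [hammingDist_comm]; exact h⟩
  loopless := ⟨fun a h => by simp at h⟩

variable [Fintype V]

/-- `π` is a transport plan from `μ₁` to `μ₂`: a function `V × V → [0,1]` with marginals
`μ₁` and `μ₂`. -/
structure IsTransportPlan (μ₁ μ₂ : V → ℝ) (π : V → V → ℝ) : Prop where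
  mem_unitInterval : ∀ x y, π x y ∈ Set.Icc (0 : ℝ) 1
  fst_marginal : ∀ x, ∑ y, π x y = μ₁ x
  snd_marginal : ∀ y, ∑ x, π x y = μ₂ y

/-- The cost of a transport plan with respect to the combinatorial distance of `G`. -/
noncomputable def cost (G : SimpleGraph V) (π : V → V → ℝ) : ℝ :=
  ∑ x, ∑ y, (G.dist x y : ℝ) * π x y

/-- The Wasserstein distance `W₁(μ₁, μ₂)` between probability measures on the vertices of `G`. -/
noncomputable def wasserstein (G : SimpleGraph V) (μ₁ μ₂ : V → ℝ) : ℝ :=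
  sInf {c : ℝ | ∃ π : V → V → ℝ, IsTransportPlan μ₁ μ₂ π ∧ cost G π = c}

variable [DecidableEq V]

/-- The probability measure `μ_x^p`, with idleness `p`. -/
noncomputable def walkMeasure (G : SimpleGraph V) [DecidableRel G.Adj] (p : ℝ) (x : V) : V → ℝ :=
  fun z => if z = x then p else if G.Adj x z then (1 - p) / (G.degree x : ℝ) else 0

/-- The `p`-Ollivier Ricci curvature `κ_p(x,y)` of two different vertices. -/
noncomputable def ollivierCurvature (G : SimpleGraph V) [DecidableRel G.Adj] (p : ℝ) (x y : V) : ℝ :=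
  1 - wasserstein G (walkMeasure G p x) (walkMeasure G p y) / (G.dist x y : ℝ)

/-- The curvature `κ(x,y) = (D+1)/D * κ_{1/(D+1)}(x,y)` of a `D`-regular graph. -/
noncomputable def curvature (G : SimpleGraph V) [DecidableRel G.Adj] (D : ℕ) (x y : V) : ℝ :=
  ((D : ℝ) + 1) / (D : ℝ) * ollivierCurvature G (1 / ((D : ℝ) + 1)) x y

/-- The infimum of the curvatures `κ(x,y)` over all edges `{x,y}` of a `D`-regular graph. -/
noncomputable def infCurvature (G : SimpleGraph V) [DecidableRel G.Adj] (D : ℕ) : ℝ :=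
  sInf {k : ℝ | ∃ x y : V, G.Adj x y ∧ curvature G D x y = k}

/-- `G` is `(D,L)`-Bonnet-Myers sharp: it is connected, `D`-regular and of diameter `L`, the
infimum of its curvature over the edges is positive, and equals `2/L`. -/
structure IsSharp (G : SimpleGraph V) [DecidableRel G.Adj] (D L : ℕ) : Prop where
  connected : G.Connected
  regular : G.IsRegularOfDegree D
  diam_eq : G.diam = L
  inf_pos : 0 < infCurvature G D
  inf_eq : infCurvature G D = 2 / (L : ℝ)

end BonnetMyers

/-! By weak Kantorovich duality, curvature at least `2/D` on an edge `xy` says that a `1`-Lipschitz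
integer potential gains at most `D - 1` from the ball sum at `x` to the ball sum at `y`
(`IsSharp.ball_sum_sub_le`). Only this inequality is used, with two kinds of potential.

Distance functions: fix `a`, `b` at distance `D`. Along a geodesic, the Laplacian of the distance to
`a` drops by at least `2` per step. Comparing with the distance to `b` turns this into an equality,
which counts lower, upper and horizontal neighbours: a vertex on level `k` has at most `k` lower
neighbours, with equality exactly when it has no horizontal ones.

Indicator potentials: for an edge in no triangle they give Hall's condition between the
neighbourhoods of its ends (`IsSharp.exists_matching`). Inductively on the level, the matchings
force exactly `k` lower neighbours and the diamond structure of a cube (`IsSharp.cubeBelow`).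

Each vertex is then labelled by the set of neighbours of `a` on geodesics to it. The diamonds make
labels grow by one element per level (`IsSharp.cubeLabel`), and counting shows that labelling is a
bijection onto the subsets of the neighbourhood of `a`, with edges corresponding to deletion of one
element. -/

namespace BonnetMyers

/-! ### Transport duality and the curvature bound as an inequality for potentials. -/

section Transport

variable {V : Type*} [Fintype V]

/-- Weak Kantorovich duality: a `1`-Lipschitz potential bounds the cost of every plan below. -/
theorem IsTransportPlan.sum_sub_sum_le_cost {G : SimpleGraph V} {μ₁ μ₂ : V → ℝ} {π : V → V → ℝ}
    (hπ : IsTransportPlan μ₁ μ₂ π) (h : V → ℤ) (hh : ∀ u v, h v - h u ≤ G.dist u v) :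
    ∑ y, (h y : ℝ) * μ₂ y - ∑ x, (h x : ℝ) * μ₁ x ≤ cost G π := by
  have h2 : ∑ y, (h y : ℝ) * μ₂ y = ∑ x, ∑ y, (h y : ℝ) * π x y := by
    rw [Finset.sum_comm]
    exact Finset.sum_congr rfl fun y _ => by rw [← hπ.snd_marginal, Finset.mul_sum]
  have h1 : ∑ x, (h x : ℝ) * μ₁ x = ∑ x, ∑ y, (h x : ℝ) * π x y :=
    Finset.sum_congr rfl fun x _ => by rw [← hπ.fst_marginal, Finset.mul_sum]
  rw [h1, h2, ← Finset.sum_sub_distrib, cost]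
  refine Finset.sum_le_sum fun x _ => ?_
  rw [← Finset.sum_sub_distrib]
  refine Finset.sum_le_sum fun y _ => ?_
  rw [← sub_mul]
  exact mul_le_mul_of_nonneg_right (by exact_mod_cast hh x y) (hπ.mem_unitInterval x y).1

/-- The product plan shows that the infimum defining `wasserstein` runs over a nonempty set;
otherwise `sInf` would default to `0`. -/
theorem isTransportPlan_mul {μ₁ μ₂ : V → ℝ} (h₁ : ∀ x, 0 ≤ μ₁ x) (h₂ : ∀ x, 0 ≤ μ₂ x)
    (s₁ : ∑ x, μ₁ x = 1) (s₂ : ∑ x, μ₂ x = 1) :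
    IsTransportPlan μ₁ μ₂ fun x y => μ₁ x * μ₂ y := by
  refine ⟨fun x y => ⟨mul_nonneg (h₁ x) (h₂ y), mul_le_one₀ ?_ (h₂ y) ?_⟩, fun x => ?_, fun y => ?_⟩
  · exact s₁ ▸ Finset.single_le_sum (fun i _ => h₁ i) (Finset.mem_univ x)
  · exact s₂ ▸ Finset.single_le_sum (fun i _ => h₂ i) (Finset.mem_univ y)
  · rw [← Finset.mul_sum, s₂, mul_one]
  · rw [← Finset.sum_mul, s₁, one_mul]

theorem sum_sub_sum_le_wasserstein {G : SimpleGraph V} {μ₁ μ₂ : V → ℝ}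
    (h₁ : ∀ x, 0 ≤ μ₁ x) (h₂ : ∀ x, 0 ≤ μ₂ x) (s₁ : ∑ x, μ₁ x = 1) (s₂ : ∑ x, μ₂ x = 1)
    (h : V → ℤ) (hh : ∀ u v, h v - h u ≤ G.dist u v) :
    ∑ y, (h y : ℝ) * μ₂ y - ∑ x, (h x : ℝ) * μ₁ x ≤ wasserstein G μ₁ μ₂ := by
  refine le_csInf ⟨_, _, isTransportPlan_mul h₁ h₂ s₁ s₂, rfl⟩ ?_
  rintro c ⟨π, hπ, rfl⟩
  exact hπ.sum_sub_sum_le_cost h hh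

variable [DecidableEq V] {G : SimpleGraph V} [DecidableRel G.Adj] {D : ℕ}

theorem sum_mul_walkMeasure (hreg : G.IsRegularOfDegree D) (hD : 0 < D) (g : V → ℝ) (x : V) :
    ∑ z, g z * walkMeasure G (1 / ((D : ℝ) + 1)) x z
      = (g x + ∑ z ∈ G.neighborFinset x, g z) / (D + 1) := by
  have hD' : (0 : ℝ) < D := by exact_mod_cast hD
  have key : ∀ z, g z * walkMeasure G (1 / ((D : ℝ) + 1)) x z
      = (if z = x then g z / (D + 1) else 0) + (if G.Adj x z then g z / (D + 1) else 0) := by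
    intro z
    have e : (1 - 1 / ((D : ℝ) + 1)) / D = 1 / (D + 1) := by field_simp; ring
    unfold walkMeasure
    rw [hreg.degree_eq x, e]
    by_cases hz : z = x
    · subst hz; simp [div_eq_mul_inv]
    · by_cases ha : G.Adj x z <;> simp [hz, ha, div_eq_mul_inv]
  rw [Finset.sum_congr rfl fun z _ => key z, Finset.sum_add_distrib, Finset.sum_ite_eq',
    ← Finset.sum_filter, ← SimpleGraph.neighborFinset_eq_filter, ← Finset.sum_div, if_pos (Finset.mem_univ x), ← add_div]

theorem walkMeasure_nonneg (x z : V) : 0 ≤ walkMeasure G (1 / ((D : ℝ) + 1)) x z := by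
  have h0 : (0 : ℝ) ≤ 1 / ((D : ℝ) + 1) := by positivity
  have h1 : 1 / ((D : ℝ) + 1) ≤ 1 := by
    rw [div_le_one (by positivity)]
    linarith [(Nat.cast_nonneg D : (0 : ℝ) ≤ D)]
  unfold walkMeasure
  split_ifs
  · exact h0
  · exact div_nonneg (by linarith) (Nat.cast_nonneg _)
  · exact le_rfl

theorem sum_walkMeasure (hreg : G.IsRegularOfDegree D) (hD : 0 < D) (x : V) :
    ∑ z, walkMeasure G (1 / ((D : ℝ) + 1)) x z = 1 := by
  have h := sum_mul_walkMeasure hreg hD (fun _ => 1) x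
  simp only [one_mul, Finset.sum_const, SimpleGraph.card_neighborFinset_eq_degree,
    hreg.degree_eq x, nsmul_eq_mul, mul_one] at h
  rw [h, add_comm, div_self (by positivity)]

theorem IsSharp.degree_pos (hG : IsSharp G D D) : 0 < D := by
  rcases Nat.eq_zero_or_pos D with h | h
  · have := hG.inf_pos
    -- For `D = 0` the value `2 / 0` is `0` by convention, against positivity.
    rw [hG.inf_eq, h] at this
    simp at this
  · exact h

/-- The lower curvature bound `2/D`, tested against a `1`-Lipschitz potential. -/
theorem IsSharp.ball_sum_sub_le (hG : IsSharp G D D) {x y : V} (hxy : G.Adj x y) (h : V → ℤ)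
    (hh : ∀ u v, h v - h u ≤ G.dist u v) :
    (h y + ∑ z ∈ G.neighborFinset y, h z) - (h x + ∑ z ∈ G.neighborFinset x, h z) ≤ D - 1 := by
  have hD := hG.degree_pos
  have hD' : (0 : ℝ) < D := by exact_mod_cast hD
  have hfin : {k : ℝ | ∃ x y : V, G.Adj x y ∧ curvature G D x y = k}.Finite := by
    refine (Set.finite_range fun p : V × V => curvature G D p.1 p.2).subset ?_
    rintro k ⟨x, y, -, rfl⟩
    exact ⟨(x, y), rfl⟩
  have hk : 2 / (D : ℝ) ≤ curvature G D x y :=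
    hG.inf_eq ▸ csInf_le hfin.bddBelow ⟨x, y, hxy, rfl⟩
  have hw := sum_sub_sum_le_wasserstein (G := G) (walkMeasure_nonneg (D := D) x)
    (walkMeasure_nonneg (D := D) y) (sum_walkMeasure hG.regular hD x)
    (sum_walkMeasure hG.regular hD y) h hh
  rw [sum_mul_walkMeasure hG.regular hD, sum_mul_walkMeasure hG.regular hD, ← sub_div,
    div_le_iff₀ (by positivity)] at hw
  rw [curvature, ollivierCurvature, SimpleGraph.dist_eq_one_iff_adj.2 hxy, Nat.cast_one, div_one,
    div_mul_eq_mul_div, div_le_div_iff_of_pos_right hD'] at hk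
  -- The curvature bound reads `(D + 1) * (1 - W₁) ≥ 2`, that is, `(D + 1) * W₁ ≤ D - 1`.
  have : ((h y : ℝ) + ∑ z ∈ G.neighborFinset y, (h z : ℝ))
      - (h x + ∑ z ∈ G.neighborFinset x, (h z : ℝ)) ≤ D - 1 := by linarith
  exact_mod_cast this

end Transport

/-! ### Perfect matchings across an edge, by Hall's theorem. -/

section Matching

variable {V : Type*} [Fintype V] [DecidableEq V] {G : SimpleGraph V} [DecidableRel G.Adj] {D : ℕ}

/-- The neighbourhoods of the ends of an edge that lies in no triangle are perfectly matched. -/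
theorem IsSharp.exists_matching (hG : IsSharp G D D) {x y : V} (hxy : G.Adj x y)
    (ht : ∀ u, G.Adj x u → ¬ G.Adj y u) :
    ∃ m : V → V, (∀ u, G.Adj x u → u ≠ y → G.Adj y (m u) ∧ m u ≠ x ∧ G.Adj u (m u)) ∧
      ∀ u v, G.Adj x u → u ≠ y → G.Adj x v → v ≠ y → m u = m v → u = v := by
  classical
  set X := (G.neighborFinset x).erase y with hX
  set Y := (G.neighborFinset y).erase x with hY
  have memX : ∀ u, u ∈ X ↔ u ≠ y ∧ G.Adj x u := fun u => by simp [hX]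
  have memY : ∀ u, u ∈ Y ↔ u ≠ x ∧ G.Adj y u := fun u => by simp [hY]
  have cX : X.card + 1 = D := by
    rw [Finset.card_erase_add_one (by simpa using hxy), SimpleGraph.card_neighborFinset_eq_degree,
      hG.regular.degree_eq]
  have cY : Y.card + 1 = D := by
    rw [Finset.card_erase_add_one (by simpa using hxy.symm),
      SimpleGraph.card_neighborFinset_eq_degree, hG.regular.degree_eq]
  have hall : ∀ s : Finset X, s.card ≤ (s.biUnion fun u => Y.filter (G.Adj u.1)).card := by
    intro s
    set A : Finset V := s.map (Function.Embedding.subtype _) with hA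
    set B := s.biUnion fun u => Y.filter (G.Adj u.1) with hB
    have hAX : A ⊆ X := by
      intro a ha
      simp only [hA, Finset.mem_map, Function.Embedding.subtype_apply] at ha
      obtain ⟨a', -, rfl⟩ := ha
      exact a'.2
    have hBY : B ⊆ Y := by
      intro b hb
      simp only [hB, Finset.mem_biUnion, Finset.mem_filter] at hb
      obtain ⟨-, -, hb, -⟩ := hb
      exact hb
    set C := Y \ B with hC
    have hAC : ∀ a ∈ A, ∀ c ∈ C, a ≠ c ∧ ¬ G.Adj a c := by
      intro a ha c hc
      rw [hC, Finset.mem_sdiff] at hc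
      refine ⟨?_, fun hac => hc.2 ?_⟩
      · rintro rfl
        exact ht a ((memX a).1 (hAX ha)).2 ((memY a).1 hc.1).2
      · simp only [hA, Finset.mem_map, Function.Embedding.subtype_apply] at ha
        obtain ⟨a', ha', rfl⟩ := ha
        simp only [hB, Finset.mem_biUnion, Finset.mem_filter]
        exact ⟨a', ha', hc.1, hac⟩
    -- `C` is the part of `Y` not adjacent to `A`, so the only jump of size `2`, from `A` to `C`,
    -- spans distance at least `2`. The ends `x`, `y` lie in both balls and cancel, leaving `|A| +
    -- |C| ≤ D - 1 = |Y|`, which is Hall's condition `|A| ≤ |B|`.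
    let h : V → ℤ := fun v => (1 + if v ∈ C then 1 else 0) - if v ∈ A then 1 else 0
    have hlip : ∀ u v, h v - h u ≤ G.dist u v := by
      intro u v
      rcases eq_or_ne u v with rfl | huv
      · simp
      have h1 : 1 ≤ G.dist u v := hG.connected.pos_dist_of_ne huv
      by_cases hv : v ∈ C
      · by_cases hu : u ∈ A
        · have h2 : G.dist u v ≠ 1 := fun e =>
            (hAC u hu v hv).2 (SimpleGraph.dist_eq_one_iff_adj.1 e)
          simp only [h]
          split_ifs <;> omega
        · simp only [h]
          split_ifs <;> omega
      · simp only [h]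
        split_ifs <;> omega
    have key := hG.ball_sum_sub_le hxy h hlip
    rw [← Finset.add_sum_erase (G.neighborFinset x) h (by simpa using hxy : y ∈ _),
      ← Finset.add_sum_erase (G.neighborFinset y) h (by simpa using hxy.symm : x ∈ _),
      ← hX, ← hY] at key
    have sY : ∑ z ∈ Y, h z = Y.card + C.card := by
      have hYA : Y ∩ A = ∅ := by
        rw [← Finset.disjoint_iff_inter_eq_empty, Finset.disjoint_left]
        exact fun a ha ha' => ht a ((memX a).1 (hAX ha')).2 ((memY a).1 ha).2
      simp only [h, Finset.sum_sub_distrib, Finset.sum_add_distrib, Finset.sum_ite_mem, hYA,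
        Finset.inter_eq_right.2 (show C ⊆ Y from Finset.sdiff_subset)]
      simp
    have sX : ∑ z ∈ X, h z = X.card - A.card := by
      have hXC : X ∩ C = ∅ := by
        rw [← Finset.disjoint_iff_inter_eq_empty, Finset.disjoint_left]
        exact fun a ha ha' => ht a ((memX a).1 ha).2 ((memY a).1 (Finset.sdiff_subset ha')).2
      simp only [h, Finset.sum_sub_distrib, Finset.sum_add_distrib, Finset.sum_ite_mem, hXC,
        Finset.inter_eq_right.2 hAX]
      simp
    have hcC : C.card + B.card = Y.card := Finset.card_sdiff_add_card_eq_card hBY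
    have hcA : A.card = s.card := Finset.card_map _
    omega
  obtain ⟨m, hm, hmm⟩ := (Finset.all_card_le_biUnion_card_iff_exists_injective _).1 hall
  refine ⟨fun u => if hu : u ∈ X then m ⟨u, hu⟩ else u, fun u hu huy => ?_,
    fun u v hu huy hv hvy huv => ?_⟩
  · have hu' : u ∈ X := (memX u).2 ⟨huy, hu⟩
    have := hmm ⟨u, hu'⟩
    rw [Finset.mem_filter, memY] at this
    simp only [hu', dif_pos]
    exact ⟨this.1.2, this.1.1, this.2⟩
  · have hu' : u ∈ X := (memX u).2 ⟨huy, hu⟩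
    have hv' : v ∈ X := (memX v).2 ⟨hvy, hv⟩
    simp only [hu', hv', dif_pos] at huv
    simpa using hm huv

end Matching


/-! ### Elementary facts on the graph distance. -/

section Dist

variable {V : Type*} {G : SimpleGraph V}

theorem dist_sub_dist_le (hc : G.Connected) (a u v : V) :
    (G.dist a v : ℤ) - G.dist a u ≤ G.dist u v := by
  have := hc.dist_triangle (u := a) (v := u) (w := v)
  omega

theorem dist_le_dist_add_one (hc : G.Connected) (a : V) {u v : V} (h : G.Adj u v) :
    G.dist a v ≤ G.dist a u + 1 := by
  have := hc.dist_triangle (u := a) (v := u) (w := v)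
  rwa [SimpleGraph.dist_eq_one_iff_adj.2 h] at this

theorem exists_adj_dist_add_one (hc : G.Connected) {a v : V} (h : a ≠ v) :
    ∃ w, G.Adj w v ∧ G.dist a w + 1 = G.dist a v := by
  obtain ⟨p, hp⟩ := hc.exists_walk_length_eq_dist v a
  cases p with
  | nil => exact absurd rfl h
  | @cons _ w _ hvw q =>
    refine ⟨w, hvw.symm, ?_⟩
    have h1 := SimpleGraph.dist_le q
    have h2 := dist_le_dist_add_one hc a hvw.symm
    rw [SimpleGraph.Walk.length_cons, SimpleGraph.dist_comm] at hp
    rw [SimpleGraph.dist_comm] at h1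
    omega

theorem dist_le_of_adj_left (hc : G.Connected) {a s : V} (h : G.Adj a s) (x : V) :
    G.dist a x ≤ G.dist s x + 1 := by
  rw [SimpleGraph.dist_comm, SimpleGraph.dist_comm (u := s)]
  exact dist_le_dist_add_one hc x h.symm

end Dist

/-! ### Lower and upper neighbours, and labels. -/

section Neighbors

variable {V : Type*} [Fintype V] {G : SimpleGraph V} [DecidableRel G.Adj]

/-- The neighbours of `v` that are closer to `a`. -/
noncomputable def lower (G : SimpleGraph V) [DecidableRel G.Adj] (a v : V) : Finset V :=
  (G.neighborFinset v).filter fun w => G.dist a w + 1 = G.dist a v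

/-- The neighbours of `v` that are farther from `a`. -/
noncomputable def upper (G : SimpleGraph V) [DecidableRel G.Adj] (a v : V) : Finset V :=
  (G.neighborFinset v).filter fun w => G.dist a w = G.dist a v + 1

theorem mem_lower {a v w : V} : w ∈ lower G a v ↔ G.Adj v w ∧ G.dist a w + 1 = G.dist a v := by
  simp [lower]

theorem mem_upper {a v w : V} : w ∈ upper G a v ↔ G.Adj v w ∧ G.dist a w = G.dist a v + 1 := by
  simp [upper]

theorem mem_upper_iff_mem_lower {a v w : V} : w ∈ upper G a v ↔ v ∈ lower G a w := by
  rw [mem_upper, mem_lower, G.adj_comm, eq_comm]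

/-- The neighbours of `a` that lie on a geodesic from `a` to `x`. -/
noncomputable def label (G : SimpleGraph V) [DecidableRel G.Adj] (a x : V) : Finset V :=
  (G.neighborFinset a).filter fun s => G.dist s x + 1 = G.dist a x

theorem mem_label {a x s : V} : s ∈ label G a x ↔ G.Adj a s ∧ G.dist s x + 1 = G.dist a x := by
  simp [label]

theorem label_subset_neighborFinset (a x : V) : label G a x ⊆ G.neighborFinset a :=
  Finset.filter_subset _ _

end Neighbors

/-! ### The Laplacian of distance functions and the neighbour counts. -/

section Laplacian

variable {V : Type*} [Fintype V] [DecidableEq V] {G : SimpleGraph V} [DecidableRel G.Adj] {D : ℕ}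

/-- The (unnormalised) Laplacian of the distance to `a`. -/
theorem IsSharp.sum_dist_le (hG : IsSharp G D D) (a v : V) :
    ∑ w ∈ G.neighborFinset v, ((G.dist a w : ℤ) - G.dist a v) ≤ D - 2 * G.dist a v := by
  have hcard : ∀ v, (G.neighborFinset v).card = D := fun v => by
    rw [SimpleGraph.card_neighborFinset_eq_degree, hG.regular.degree_eq]
  induction hk : G.dist a v generalizing v with
  | zero =>
    have : a = v := hG.connected.dist_eq_zero_iff.1 hk
    subst this
    refine (Finset.sum_le_card_nsmul _ _ 1 fun w hw => ?_).trans (by simp [hcard])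
    rw [SimpleGraph.mem_neighborFinset] at hw
    simp [SimpleGraph.dist_eq_one_iff_adj.2 hw]
  | succ k ih =>
    have hav : a ≠ v := by
      rintro rfl
      simp at hk
    obtain ⟨u, huv, hu⟩ := exists_adj_dist_add_one hG.connected hav
    have hu' : G.dist a u = k := by omega
    have h1 := ih u hu'
    have h2 := hG.ball_sum_sub_le huv (fun w => (G.dist a w : ℤ))
      (dist_sub_dist_le hG.connected a)
    -- Moving from level `k` to `k + 1` raises the subtracted ball average by `D + 1`, while the
    -- ball sum gains at most `D - 1`: the Laplacian drops by at least `2`.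
    simp only [Finset.sum_sub_distrib, Finset.sum_const, hcard, nsmul_eq_mul, hk, hu'] at h1 h2 ⊢
    push_cast at h1 h2 ⊢
    linarith

/-- Every vertex lies on a geodesic between two vertices at maximal distance. -/
theorem IsSharp.dist_add_dist (hG : IsSharp G D D) {a b : V} (hab : G.dist a b = D) (v : V) :
    G.dist a v + G.dist v b = D := by
  have hge : ∀ v, D ≤ G.dist a v + G.dist v b := fun v =>
    hab ▸ hG.connected.dist_triangle
  obtain ⟨p⟩ := hG.connected.preconnected v a
  induction p with
  | nil => simpa using hab
  | @cons u v a huv q ih =>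
    have ih := ih hab hge
    have ha := hG.sum_dist_le a v
    have hb := hG.sum_dist_le b v
    simp only [SimpleGraph.dist_comm (u := b)] at hb
    -- Minimum principle: the excess is nonnegative and vanishes at `v`, where its Laplacian is
    -- nonpositive, so it vanishes at all neighbours.
    have hs : ∑ w ∈ G.neighborFinset v, ((G.dist a w + G.dist w b : ℤ) - D) ≤ 0 := by
      have e : ∑ w ∈ G.neighborFinset v, ((G.dist a w + G.dist w b : ℤ) - D)
          = ∑ w ∈ G.neighborFinset v, ((G.dist a w : ℤ) - G.dist a v)
            + ∑ w ∈ G.neighborFinset v, ((G.dist w b : ℤ) - G.dist v b) := by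
        rw [← Finset.sum_add_distrib]
        refine Finset.sum_congr rfl fun w _ => ?_
        rw [← ih]
        push_cast
        ring
      rw [e]
      have : (G.dist a v : ℤ) + G.dist v b = D := by exact_mod_cast ih
      linarith
    have hle := (Finset.single_le_sum (f := fun w => (G.dist a w + G.dist w b : ℤ) - D)
      (fun w _ => by have := hge w; omega)
      ((SimpleGraph.mem_neighborFinset G v u).2 huv.symm)).trans hs
    have := hge u
    omega

theorem IsSharp.exists_dist_eq (hG : IsSharp G D D) : ∃ a b, G.dist a b = D := by
  have := hG.connected.nonempty
  obtain ⟨a, b, h⟩ := G.exists_dist_eq_diam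
  exact ⟨a, b, h.trans hG.diam_eq⟩

theorem IsSharp.sum_dist_eq (hG : IsSharp G D D) {a b : V} (hab : G.dist a b = D) (v : V) :
    ∑ w ∈ G.neighborFinset v, ((G.dist a w : ℤ) - G.dist a v) = D - 2 * G.dist a v := by
  refine le_antisymm (hG.sum_dist_le a v) ?_
  have hb := hG.sum_dist_le b v
  have e : ∀ w, (G.dist b w : ℤ) = D - G.dist a w := fun w => by
    have := hG.dist_add_dist hab w
    rw [SimpleGraph.dist_comm (u := b)]
    omega
  have : ∑ w ∈ G.neighborFinset v, ((G.dist b w : ℤ) - G.dist b v)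
      = - ∑ w ∈ G.neighborFinset v, ((G.dist a w : ℤ) - G.dist a v) := by
    rw [← Finset.sum_neg_distrib]
    refine Finset.sum_congr rfl fun w _ => ?_
    rw [e, e]
    ring
  rw [this, e] at hb
  linarith

/-- Here `n` counts the horizontal neighbours; the second equation combines the degree with the
Laplacian `D - 2 * G.dist a v`. -/
theorem IsSharp.card_lower_upper (hG : IsSharp G D D) {a b : V} (hab : G.dist a b = D) (v : V) :
    ∃ n, (lower G a v).card + (upper G a v).card + n = D ∧
      2 * (lower G a v).card + n = 2 * G.dist a v ∧
      (n = 0 → ∀ w, G.Adj v w → G.dist a w ≠ G.dist a v) := by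
  refine ⟨((G.neighborFinset v).filter fun w => G.dist a w = G.dist a v).card, ?_⟩
  have hs := hG.sum_dist_eq hab v
  have hd : ∀ w ∈ G.neighborFinset v, (G.dist a w : ℤ) - G.dist a v
      = (if G.dist a w = G.dist a v + 1 then 1 else 0)
        - (if G.dist a w + 1 = G.dist a v then 1 else 0) ∧
      (1 : ℤ) = (if G.dist a w = G.dist a v + 1 then 1 else 0)
        + (if G.dist a w + 1 = G.dist a v then 1 else 0)
        + (if G.dist a w = G.dist a v then 1 else 0) := by
    intro w hw
    rw [SimpleGraph.mem_neighborFinset] at hw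
    have h1 := dist_le_dist_add_one hG.connected a hw
    have h2 := dist_le_dist_add_one hG.connected a hw.symm
    constructor <;> split_ifs <;> omega
  rw [Finset.sum_congr rfl fun w hw => (hd w hw).1, Finset.sum_sub_distrib, Finset.sum_boole,
    Finset.sum_boole] at hs
  have hc : ∑ w ∈ G.neighborFinset v, (1 : ℤ) = D := by
    rw [Finset.sum_const, SimpleGraph.card_neighborFinset_eq_degree, hG.regular.degree_eq]
    simp
  rw [Finset.sum_congr rfl fun w hw => (hd w hw).2, Finset.sum_add_distrib,
    Finset.sum_add_distrib, Finset.sum_boole, Finset.sum_boole, Finset.sum_boole] at hc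
  simp only [lower, upper]
  refine ⟨by omega, by omega, fun h0 w hw hwv => ?_⟩
  rw [Finset.card_eq_zero] at h0
  have : w ∈ (G.neighborFinset v).filter fun w => G.dist a w = G.dist a v := by simp [hw, hwv]
  simp [h0] at this

end Laplacian

/-! ### Cube structure between consecutive levels. -/

section Levels

variable {V : Type*} [Fintype V] [DecidableEq V] {G : SimpleGraph V} [DecidableRel G.Adj] {D : ℕ}

/-- The vertex `x` has as many lower neighbours as in a hypercube. -/
noncomputable def IsRegularBelow (G : SimpleGraph V) [DecidableRel G.Adj] (a x : V) : Prop :=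
  (lower G a x).card = G.dist a x

theorem IsSharp.dist_ne_of_adj (hG : IsSharp G D D) {a b : V} (hab : G.dist a b = D) {x w : V}
    (hx : IsRegularBelow G a x) (hw : G.Adj x w) : G.dist a w ≠ G.dist a x := by
  obtain ⟨n, -, h2, h3⟩ := hG.card_lower_upper hab x
  rw [IsRegularBelow] at hx
  exact h3 (by omega) w hw

theorem IsSharp.card_upper (hG : IsSharp G D D) {a b : V} (hab : G.dist a b = D) {x : V}
    (hx : IsRegularBelow G a x) : (upper G a x).card + G.dist a x = D := by
  obtain ⟨n, h1, h2, -⟩ := hG.card_lower_upper hab x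
  rw [IsRegularBelow] at hx
  omega

/-- The upper neighbours of `x` are matched, over a lower neighbour `z` of `x`, with vertices on
the level of `x`. -/
theorem IsSharp.exists_level_matching (hG : IsSharp G D D) {a b : V} (hab : G.dist a b = D)
    {x z : V} (hx : IsRegularBelow G a x) (hz : IsRegularBelow G a z) (hzx : z ∈ lower G a x) :
    ∃ m : V → V, (∀ y, x ∈ lower G a y → m y ∈ lower G a y ∧ m y ≠ x ∧ z ∈ lower G a (m y)) ∧
      ∀ y y', x ∈ lower G a y → x ∈ lower G a y' → m y = m y' → y = y' := by
  rw [mem_lower] at hzx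
  have ht : ∀ u, G.Adj x u → ¬ G.Adj z u := by
    intro u hxu hzu
    have h1 := hG.dist_ne_of_adj hab hx hxu
    have h2 := hG.dist_ne_of_adj hab hz hzu
    have h3 := dist_le_dist_add_one hG.connected a hxu.symm
    have h4 := dist_le_dist_add_one hG.connected a hzu
    omega
  obtain ⟨m, hm, hinj⟩ := hG.exists_matching hzx.1 ht
  have aux : ∀ y, x ∈ lower G a y → G.Adj x y ∧ y ≠ z := by
    intro y hy
    rw [mem_lower] at hy
    refine ⟨hy.1.symm, ?_⟩
    rintro rfl
    omega
  refine ⟨m, fun y hy => ?_, fun y y' hy hy' =>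
    hinj y y' (aux y hy).1 (aux y hy).2 (aux y' hy').1 (aux y' hy').2⟩
  obtain ⟨h1, h2, h3⟩ := hm y (aux y hy).1 (aux y hy).2
  rw [mem_lower] at hy
  have h4 := dist_le_dist_add_one hG.connected a h1
  have h5 := dist_le_dist_add_one hG.connected a h3.symm
  refine ⟨mem_lower.2 ⟨h3, by omega⟩, h2, mem_lower.2 ⟨h1.symm, by omega⟩⟩

/-- The local structure of a hypercube below the vertex `x`. -/
structure CubeBelow (G : SimpleGraph V) [DecidableRel G.Adj] (a x : V) : Prop where
  card_lower : IsRegularBelow G a x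
  /-- a vertex two levels below `x` has at most two common neighbours with `x` -/
  diamond_unique : ∀ z ∈ lower G a x, ∀ z₁ ∈ lower G a x, ∀ z₂ ∈ lower G a x, ∀ w,
    w ∈ lower G a z → w ∈ lower G a z₁ → w ∈ lower G a z₂ → z ≠ z₁ → z ≠ z₂ → z₁ = z₂
  exists_common : ∀ z ∈ lower G a x, ∀ z' ∈ lower G a x, z ≠ z' →
    ∃ w, w ∈ lower G a z ∧ w ∈ lower G a z'
  common_unique : ∀ x', G.dist a x' = G.dist a x → x ≠ x' → ∀ z ∈ lower G a x,
    ∀ z' ∈ lower G a x, z ∈ lower G a x' → z' ∈ lower G a x' → z = z'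

theorem dist_eq_of_mem_lower {a x z z' : V} (h : z ∈ lower G a x) (h' : z' ∈ lower G a x) :
    G.dist a z = G.dist a z' := by
  rw [mem_lower] at h h'
  omega

theorem cubeBelow_of_dist_zero {a x : V} (hx : G.dist a x = 0) :
    CubeBelow G a x := by
  have he : lower G a x = ∅ := by
    ext w
    simp [mem_lower, hx]
  refine ⟨by rw [IsRegularBelow, he, hx, Finset.card_empty], ?_, ?_, ?_⟩ <;> simp [he]

/-- The lower neighbours of `y` are parametrised by a fixed one, `x`, and its lower neighbours. -/
theorem IsSharp.exists_lower_param (hG : IsSharp G D D) {a b : V} (hab : G.dist a b = D)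
    {x y : V} (hxy : x ∈ lower G a y) (hx : CubeBelow G a x)
    (hlow : ∀ z ∈ lower G a x, IsRegularBelow G a z) :
    IsRegularBelow G a y ∧ ∃ c : V → V,
      (∀ z ∈ lower G a x, c z ∈ lower G a y ∧ c z ≠ x ∧ z ∈ lower G a (c z)) ∧
      (∀ x' ∈ lower G a y, x' ≠ x → ∃ z ∈ lower G a x, c z = x') := by
  choose! m hm _ using fun z (hz : z ∈ lower G a x) =>
    hG.exists_level_matching hab hx.card_lower (hlow z hz) hz
  have hc : ∀ z ∈ lower G a x, m z y ∈ lower G a y ∧ m z y ≠ x ∧ z ∈ lower G a (m z y) :=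
    fun z hz => hm z hz y hxy
  -- Injectivity gives `y` at least as many lower neighbours as its level, and the Laplacian count
  -- allows no more; hence equality, and surjectivity onto those other than `x`.
  have hinj : Set.InjOn (fun z => m z y) (lower G a x) := by
    intro z hz z' hz' e
    simp only at e
    refine hx.common_unique (m z y) (dist_eq_of_mem_lower (hc z hz).1 hxy) (hc z hz).2.1.symm
      z hz z' hz' (hc z hz).2.2 (e ▸ (hc z' hz').2.2)
  have hsub : (lower G a x).image (fun z => m z y) ⊆ (lower G a y).erase x := by
    intro w hw
    obtain ⟨z, hz, rfl⟩ := Finset.mem_image.1 hw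
    exact Finset.mem_erase.2 ⟨(hc z hz).2.1, (hc z hz).1⟩
  have h1 := Finset.card_le_card hsub
  rw [Finset.card_image_of_injOn hinj, hx.card_lower] at h1
  have h2 := Finset.card_erase_add_one hxy
  obtain ⟨n, -, h3, -⟩ := hG.card_lower_upper hab y
  have h4 := (mem_lower.1 hxy).2
  have hy : (lower G a y).card = G.dist a y := by omega
  refine ⟨hy, fun z => m z y, hc, fun x' hx' hne => ?_⟩
  have heq := Finset.eq_of_subset_of_card_le hsub
    (by rw [Finset.card_image_of_injOn hinj, hx.card_lower]; omega)
  have : x' ∈ (lower G a y).erase x := Finset.mem_erase.2 ⟨hne, hx'⟩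
  rw [← heq] at this
  simpa using this

/-- Strong induction on the level: the parametrisation yields all fields but `common_unique`, which
follows from injectivity of a matching one level down. -/
theorem IsSharp.cubeBelow (hG : IsSharp G D D) {a b : V} (hab : G.dist a b = D) (x : V) :
    CubeBelow G a x := by
  induction hk : G.dist a x using Nat.strong_induction_on generalizing x with
  | _ k ih =>
  have low : ∀ y, G.dist a y = k → ∀ x ∈ lower G a y, CubeBelow G a x := fun y hy x hxy =>
    ih _ (by have := (mem_lower.1 hxy).2; omega) x rfl
  have low2 : ∀ y, G.dist a y = k → ∀ x ∈ lower G a y, ∀ z ∈ lower G a x, CubeBelow G a z :=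
    fun y hy x hxy z hzx =>
      ih _ (by have := (mem_lower.1 hxy).2; have := (mem_lower.1 hzx).2; omega) z rfl
  have param : ∀ y, G.dist a y = k → ∀ x ∈ lower G a y, _ := fun y hy x hxy =>
    hG.exists_lower_param hab hxy (low y hy x hxy) fun z hz => (low2 y hy x hxy z hz).card_lower
  have hcommon : ∀ y, G.dist a y = k → ∀ x ∈ lower G a y, ∀ x' ∈ lower G a y, x ≠ x' →
      ∃ z, z ∈ lower G a x ∧ z ∈ lower G a x' := by
    intro y hy x hx x' hx' hne
    obtain ⟨-, c, hc, hs⟩ := param y hy x hx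
    obtain ⟨z, hz, rfl⟩ := hs x' hx' hne.symm
    exact ⟨z, hz, (hc z hz).2.2⟩
  have hdiamond : ∀ y, G.dist a y = k → ∀ x ∈ lower G a y, ∀ x₁ ∈ lower G a y,
      ∀ x₂ ∈ lower G a y, ∀ z, z ∈ lower G a x → z ∈ lower G a x₁ → z ∈ lower G a x₂ →
      x ≠ x₁ → x ≠ x₂ → x₁ = x₂ := by
    intro y hy x hx x₁ hx₁ x₂ hx₂ z hz hz₁ hz₂ hne₁ hne₂
    obtain ⟨-, c, hc, hs⟩ := param y hy x hx
    have key : ∀ x' ∈ lower G a y, x ≠ x' → z ∈ lower G a x' → x' = c z := by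
      intro x' hx' hne hzx'
      obtain ⟨z', hz', rfl⟩ := hs x' hx' hne.symm
      rw [(low y hy x hx).common_unique _ (dist_eq_of_mem_lower hx' hx) hne z hz z' hz' hzx'
        (hc z' hz').2.2]
    rw [key x₁ hx₁ hne₁ hz₁, key x₂ hx₂ hne₂ hz₂]
  rcases Nat.eq_zero_or_pos k with h0 | hpos
  · exact cubeBelow_of_dist_zero (hk.trans h0)
  have hax : a ≠ x := by
    rintro rfl
    simp at hk
    omega
  obtain ⟨u, hux, hu⟩ := exists_adj_dist_add_one hG.connected hax
  refine ⟨(param x hk u (mem_lower.2 ⟨hux.symm, hu⟩)).1, hdiamond x hk, hcommon x hk, ?_⟩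
  intro x' hx' hne z hz z' hz' hzx' hzx''
  by_contra hzz
  obtain ⟨w, hw, hw'⟩ := hcommon x hk z hz z' hz' hzz
  obtain ⟨m, hm, hinj⟩ := hG.exists_level_matching hab (low x hk z hz).card_lower
    (low2 x hk z hz w hw).card_lower hw
  -- Below any `y` above both `z` and `z'`, the vertices `m y` and `z'` both complete the diamond of
  -- `y`, `z`, `w`; so `x` and `x'` have the same match `z'`.
  have e : ∀ y, G.dist a y = k → z ∈ lower G a y → z' ∈ lower G a y → m y = z' :=
    fun y hy h h' => hdiamond y hy z h (m y) (hm y h).1 z' h' w hw (hm y h).2.2 hw'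
      (hm y h).2.1.symm hzz
  exact hne (hinj x x' hz hzx' ((e x hk hz hz').trans (e x' (hx'.trans hk) hzx' hzx'').symm))

end Levels

/-! ### Labels as subsets of the neighbourhood of `a`. -/

section Labels

variable {V : Type*} [Fintype V] [DecidableEq V] {G : SimpleGraph V} [DecidableRel G.Adj] {D : ℕ}

theorem label_of_dist_zero {a x : V} (h : G.dist a x = 0) : label G a x = ∅ := by
  ext s
  simp [mem_label, h]

theorem label_of_dist_one (hc : G.Connected) {a x : V} (h : G.dist a x = 1) :
    label G a x = {x} := by
  ext s
  rw [mem_label, h, Finset.mem_singleton, Nat.add_eq_right, hc.dist_eq_zero_iff]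
  refine ⟨fun h => h.2, ?_⟩
  rintro rfl
  exact ⟨SimpleGraph.dist_eq_one_iff_adj.1 h, rfl⟩

theorem mem_label_iff_exists_lower (hc : G.Connected) {a x s : V} (h : 2 ≤ G.dist a x) :
    s ∈ label G a x ↔ ∃ z ∈ lower G a x, s ∈ label G a z := by
  constructor
  · intro hs
    rw [mem_label] at hs
    have hsx : s ≠ x := by
      rintro rfl
      simp at hs
      omega
    obtain ⟨z, hzx, hz⟩ := exists_adj_dist_add_one hc hsx
    have h1 := dist_le_of_adj_left hc hs.1 z
    have h2 := dist_le_dist_add_one hc a hzx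
    exact ⟨z, mem_lower.2 ⟨hzx.symm, by omega⟩, mem_label.2 ⟨hs.1, by omega⟩⟩
  · rintro ⟨z, hz, hs⟩
    rw [mem_lower] at hz
    rw [mem_label] at hs ⊢
    have h1 := dist_le_of_adj_left hc hs.1 x
    have h2 := dist_le_dist_add_one hc s hz.1.symm
    exact ⟨hs.1, by omega⟩

theorem label_subset_of_mem_lower (hc : G.Connected) {a x z : V} (h : z ∈ lower G a x) :
    label G a z ⊆ label G a x := by
  intro s hs
  rw [mem_lower] at h
  rw [mem_label] at hs ⊢
  have h1 := dist_le_of_adj_left hc hs.1 x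
  have h2 := dist_le_dist_add_one hc s h.1.symm
  exact ⟨hs.1, by omega⟩

/-- The labels below `x` are as in a hypercube. -/
structure CubeLabel (G : SimpleGraph V) [DecidableRel G.Adj] (a x : V) : Prop where
  card_label : (label G a x).card = G.dist a x
  exists_lower : ∀ c ∈ label G a x, ∃ z ∈ lower G a x, label G a z = (label G a x).erase c
  injective : ∀ x', G.dist a x' = G.dist a x → label G a x = label G a x' → x = x'

/-- One step down, labels lose one element. -/
theorem exists_erase_of_mem_lower (hc : G.Connected) {a x z : V} (h : z ∈ lower G a x)
    (hx : (label G a x).card = G.dist a x) (hz : (label G a z).card = G.dist a z) :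
    ∃ c ∈ label G a x, label G a z = (label G a x).erase c := by
  have h2 := (mem_lower.1 h).2
  obtain ⟨c, hcx, e⟩ := Finset.exists_eq_insert_iff.2
    ⟨label_subset_of_mem_lower hc h, by omega⟩
  exact ⟨c, by simp [← e], by rw [← e, Finset.erase_insert hcx]⟩

/-- One step up, labels gain one element. -/
theorem exists_insert_of_mem_lower (hc : G.Connected) {a x z : V} (h : z ∈ lower G a x)
    (hx : (label G a x).card = G.dist a x) (hz : (label G a z).card = G.dist a z) :
    ∃ c ∉ label G a z, label G a x = insert c (label G a z) := by
  have h2 := (mem_lower.1 h).2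
  obtain ⟨c, hcx, e⟩ := Finset.exists_eq_insert_iff.2
    ⟨label_subset_of_mem_lower hc h, by omega⟩
  exact ⟨c, hcx, e.symm⟩

/-- Sets obtained from a common set by exchanging one element, which pairwise also differ by such
an exchange, receive the same new element if they lose different ones. -/
theorem insert_erase_exchange {α : Type*} [DecidableEq α] {S U : Finset α} {a₁ a₂ b₁ b₂ c₁ c₂ : α}
    (ha₂ : a₂ ∈ S) (ha : a₁ ≠ a₂) (hb₁ : b₁ ∉ S) (hb₂ : b₂ ∉ S)
    (h₁ : insert b₁ (S.erase a₁) = insert c₁ U) (h₂ : insert b₂ (S.erase a₂) = insert c₂ U) :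
    b₁ = b₂ := by
  by_contra hb
  have e1 : a₂ ∈ insert c₁ U := by
    rw [← h₁]
    exact Finset.mem_insert_of_mem (Finset.mem_erase.2 ⟨ha.symm, ha₂⟩)
  have e2 : b₁ ∈ insert c₁ U := by
    rw [← h₁]
    exact Finset.mem_insert_self _ _
  have n1 : a₂ ∉ U := by
    intro h
    have : a₂ ∈ insert b₂ (S.erase a₂) := by
      rw [h₂]
      exact Finset.mem_insert_of_mem h
    rcases Finset.mem_insert.1 this with h | h
    · exact hb₂ (h ▸ ha₂)
    · exact Finset.notMem_erase _ _ h
  have n2 : b₁ ∉ U := by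
    intro h
    have : b₁ ∈ insert b₂ (S.erase a₂) := by
      rw [h₂]
      exact Finset.mem_insert_of_mem h
    rcases Finset.mem_insert.1 this with h | h
    · exact hb h
    · exact hb₁ (Finset.mem_of_mem_erase h)
  have h3 := (Finset.mem_insert.1 e1).resolve_right n1
  have h4 := (Finset.mem_insert.1 e2).resolve_right n2
  exact hb₁ (h4.trans h3.symm ▸ ha₂)

/-- At distance at least two from `a`, labels have the size of the distance. -/
theorem card_label_of_lower (hc : G.Connected) {a x : V} (hx2 : 2 ≤ G.dist a x)
    (hx : CubeBelow G a x) (hlow : ∀ z ∈ lower G a x, CubeLabel G a z)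
    (hlow2 : ∀ z ∈ lower G a x, ∀ w ∈ lower G a z, CubeLabel G a w) :
    (label G a x).card = G.dist a x := by
  have hne : 2 ≤ (lower G a x).card := hx.card_lower.symm ▸ hx2
  obtain ⟨z, hz, z₀, hz₀, hzz₀⟩ := Finset.one_lt_card.1 hne
  have hdz := (mem_lower.1 hz).2
  have exch : ∀ z' ∈ lower G a x, z ≠ z' → ∃ w ∈ lower G a z, w ∈ lower G a z' ∧
      ∃ p ∈ label G a z, label G a w = (label G a z).erase p ∧
        ∃ q ∉ label G a z, label G a z' = insert q ((label G a z).erase p) := by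
    intro z' hz' hzz'
    obtain ⟨w, hw, hw'⟩ := hx.exists_common z hz z' hz' hzz'
    obtain ⟨p, hp, ep⟩ := exists_erase_of_mem_lower hc hw (hlow z hz).card_label
      (hlow2 z hz w hw).card_label
    obtain ⟨q, hq, eq⟩ := exists_insert_of_mem_lower hc hw' (hlow z' hz').card_label
      (hlow2 z hz w hw).card_label
    rw [ep] at hq eq
    refine ⟨w, hw, hw', p, hp, ep, q, fun hqz => ?_, eq⟩
    have hqp : q = p := by
      by_contra hne
      exact hq (Finset.mem_erase.2 ⟨hne, hqz⟩)
    rw [hqp, Finset.insert_erase hp] at eq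
    exact hzz' ((hlow z hz).injective z' (dist_eq_of_mem_lower hz' hz) eq.symm)
  obtain ⟨w₀, hw₀, hw₀', p₀, hp₀, ew₀, q₀, hq₀, e₀⟩ := exch z₀ hz₀ hzz₀
  -- The label of `x` is the union of the labels below it; every lower neighbour other than `z` adds
  -- the same element `q₀` to that of `z`.
  have hsub : label G a x = insert q₀ (label G a z) := by
    apply Finset.Subset.antisymm
    · intro s hs
      obtain ⟨z', hz', hs'⟩ := (mem_label_iff_exists_lower hc hx2).1 hs
      rcases eq_or_ne z z' with rfl | hzz'
      · exact Finset.mem_insert_of_mem hs'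
      obtain ⟨w, hw, hw', p, hp, ew, q, hq, e⟩ := exch z' hz' hzz'
      have hqq : q = q₀ := by
        rcases eq_or_ne z' z₀ with rfl | hne
        · have : q ∈ insert q₀ ((label G a z).erase p₀) := by
            rw [← e₀, e]
            exact Finset.mem_insert_self _ _
          rcases Finset.mem_insert.1 this with h | h
          · exact h
          · exact absurd (Finset.mem_of_mem_erase h) hq
        · obtain ⟨v, hv, hv'⟩ := hx.exists_common z' hz' z₀ hz₀ hne
          obtain ⟨c, -, ec⟩ := exists_insert_of_mem_lower hc hv (hlow z' hz').card_label
            (hlow2 z' hz' v hv).card_label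
          obtain ⟨c', -, ec'⟩ := exists_insert_of_mem_lower hc hv' (hlow z₀ hz₀).card_label
            (hlow2 z' hz' v hv).card_label
          refine insert_erase_exchange hp₀ ?_ hq hq₀ (e.symm.trans ec) (e₀.symm.trans ec')
          -- If `z'` and `z₀` lost the same element, then `w = w₀` would lie below three distinct
          -- lower neighbours of `x`.
          rintro rfl
          have hww : w = w₀ := (hlow2 z hz w hw).injective w₀
            (dist_eq_of_mem_lower hw₀ hw) (ew.trans ew₀.symm)
          subst hww
          exact hne (hx.diamond_unique z hz z' hz' z₀ hz₀ w hw hw' hw₀' hzz' hzz₀)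
      rw [e, hqq] at hs'
      exact Finset.insert_subset_insert _ (Finset.erase_subset _ _) hs'
    · refine Finset.insert_subset (label_subset_of_mem_lower hc hz₀ ?_)
        (label_subset_of_mem_lower hc hz)
      rw [e₀]
      exact Finset.mem_insert_self _ _
  rw [hsub, Finset.card_insert_of_notMem hq₀, (hlow z hz).card_label, hdz]

theorem IsSharp.cubeLabel (hG : IsSharp G D D) {a b : V} (hab : G.dist a b = D) (x : V) :
    CubeLabel G a x := by
  induction hk : G.dist a x using Nat.strong_induction_on generalizing x with
  | _ k ih =>
  have hc := hG.connected
  have low : ∀ y, G.dist a y = k → ∀ x ∈ lower G a y, CubeLabel G a x := fun y hy x hxy =>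
    ih _ (by have := (mem_lower.1 hxy).2; omega) x rfl
  have low2 : ∀ y, G.dist a y = k → ∀ x ∈ lower G a y, ∀ z ∈ lower G a x, CubeLabel G a z :=
    fun y hy x hxy z hzx =>
      ih _ (by have := (mem_lower.1 hxy).2; have := (mem_lower.1 hzx).2; omega) z rfl
  have card : ∀ y, G.dist a y = k → (label G a y).card = G.dist a y := by
    intro y hy
    rcases Nat.lt_or_ge (G.dist a y) 2 with h | h
    · interval_cases h' : G.dist a y
      · simp [label_of_dist_zero h']
      · simp [label_of_dist_one hc h']
    · exact card_label_of_lower hc h (hG.cubeBelow hab y) (low y hy) (low2 y hy)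
  have ex : ∀ y, G.dist a y = k → ∀ c ∈ label G a y,
      ∃ z ∈ lower G a y, label G a z = (label G a y).erase c := by
    intro y hy c hcy
    choose! f hf ef using fun z (hz : z ∈ lower G a y) =>
      exists_erase_of_mem_lower hc hz (card y hy) (low y hy z hz).card_label
    -- There are as many lower neighbours as label elements, and distinct ones lose distinct
    -- elements, so every element is lost once.
    obtain ⟨z, hz, rfl⟩ := Finset.surj_on_of_inj_on_of_card_le (fun z _ => f z) hf
      (fun z z' hz hz' e => (low y hy z hz).injective z' (dist_eq_of_mem_lower hz' hz)
        (by rw [ef z hz, ef z' hz', e]))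
      (by rw [card y hy, (hG.cubeBelow hab y).card_lower]) c hcy
    exact ⟨z, hz, ef z hz⟩
  refine ⟨card x hk, ex x hk, fun x' hx' e => ?_⟩
  rcases Nat.lt_or_ge (G.dist a x) 2 with h | h
  · interval_cases h' : G.dist a x
    · exact (hc.dist_eq_zero_iff.1 h').symm.trans (hc.dist_eq_zero_iff.1 hx')
    · rwa [label_of_dist_one hc h', label_of_dist_one hc hx', Finset.singleton_inj] at e
  -- Vertices with equal labels of size at least `2` share the lower neighbours obtained by deleting
  -- `c` and `c'`, against `common_unique`.
  · by_contra hne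
    have hcard : 1 < (label G a x).card := by rw [card x hk]; omega
    obtain ⟨c, hcx, c', hcx', hcc⟩ := Finset.one_lt_card.1 hcard
    have common : ∀ c ∈ label G a x, ∃ z ∈ lower G a x, z ∈ lower G a x' ∧
        label G a z = (label G a x).erase c := by
      intro c hcx
      obtain ⟨z, hz, ez⟩ := ex x hk c hcx
      obtain ⟨z', hz', ez'⟩ := ex x' (hx'.trans hk) c (e ▸ hcx)
      have hd : G.dist a z' = G.dist a z := by
        have h1 := (mem_lower.1 hz).2
        have h2 := (mem_lower.1 hz').2
        omega
      have : z = z' := (low x hk z hz).injective z' hd (by rw [ez, ez', e])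
      subst this
      exact ⟨z, hz, hz', ez⟩
    obtain ⟨z, hz, hzx', ez⟩ := common c hcx
    obtain ⟨z', hz', hzx'', ez'⟩ := common c' hcx'
    have := (hG.cubeBelow hab x).common_unique x' hx' hne z hz z' hz' hzx' hzx''
    subst this
    have : c ∈ (label G a x).erase c := by
      rw [← ez, ez']
      exact Finset.mem_erase.2 ⟨hcc, hcx⟩
    exact Finset.notMem_erase _ _ this

/-! ### The isomorphism with the hypercube. -/

theorem IsSharp.label_injective (hG : IsSharp G D D) {a b : V} (hab : G.dist a b = D) :
    Function.Injective (label G a) := fun x y e =>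
  (hG.cubeLabel hab x).injective y
    (by rw [← (hG.cubeLabel hab x).card_label, ← (hG.cubeLabel hab y).card_label, e]) e

theorem IsSharp.exists_label_eq (hG : IsSharp G D D) {a b : V} (hab : G.dist a b = D)
    (A : Finset V) (hA : A ⊆ G.neighborFinset a) : ∃ x, label G a x = A := by
  induction A using Finset.induction_on with
  | empty => exact ⟨a, label_of_dist_zero SimpleGraph.dist_self⟩
  | @insert s A hs ih =>
    obtain ⟨x, rfl⟩ := ih ((Finset.subset_insert _ _).trans hA)
    have hx := hG.cubeLabel hab x
    choose! f hf ef using fun y (hy : y ∈ upper G a x) =>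
      exists_insert_of_mem_lower hG.connected (mem_upper_iff_mem_lower.1 hy)
        (hG.cubeLabel hab y).card_label hx.card_label
    have h1 := hG.card_upper hab (hG.cubeBelow hab x).card_lower
    have h2 := Finset.card_sdiff_add_card_eq_card (label_subset_neighborFinset (G := G) a x)
    rw [SimpleGraph.card_neighborFinset_eq_degree, hG.regular.degree_eq, hx.card_label] at h2
    -- On level `k` there are `D - k` upper neighbours and `D - k` elements outside the label, so
    -- each such element is gained by some upper neighbour.
    obtain ⟨y, hy, e⟩ := Finset.surj_on_of_inj_on_of_card_le
      (s := upper G a x) (t := G.neighborFinset a \ label G a x) (fun y _ => f y)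
      (fun y hy => Finset.mem_sdiff.2
        ⟨label_subset_neighborFinset a y (by rw [ef y hy]; exact Finset.mem_insert_self _ _),
          hf y hy⟩)
      (fun y y' hy hy' e => hG.label_injective hab (by rw [ef y hy, ef y' hy', e]))
      (by omega) s (Finset.mem_sdiff.2 ⟨hA (Finset.mem_insert_self _ _), hs⟩)
    exact ⟨y, by rw [ef y hy, e]⟩

theorem IsSharp.mem_lower_iff_label (hG : IsSharp G D D) {a b : V} (hab : G.dist a b = D)
    {x y : V} : y ∈ lower G a x ↔ ∃ c ∈ label G a x, label G a y = (label G a x).erase c := by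
  refine ⟨fun h => exists_erase_of_mem_lower hG.connected h (hG.cubeLabel hab x).card_label
    (hG.cubeLabel hab y).card_label, ?_⟩
  rintro ⟨c, hc, e⟩
  obtain ⟨z, hz, ez⟩ := (hG.cubeLabel hab x).exists_lower c hc
  rwa [hG.label_injective hab (e.trans ez.symm)]

theorem IsSharp.adj_iff_mem_lower (hG : IsSharp G D D) {a b : V} (hab : G.dist a b = D)
    {x y : V} : G.Adj x y ↔ y ∈ lower G a x ∨ x ∈ lower G a y := by
  constructor
  · intro h
    have h1 := hG.dist_ne_of_adj hab (hG.cubeBelow hab x).card_lower h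
    have h2 := dist_le_dist_add_one hG.connected a h
    have h3 := dist_le_dist_add_one hG.connected a h.symm
    rw [mem_lower, mem_lower]
    by_cases h4 : G.dist a y + 1 = G.dist a x
    · exact Or.inl ⟨h, h4⟩
    · exact Or.inr ⟨h.symm, by omega⟩
  · rintro (h | h)
    · exact (mem_lower.1 h).1
    · exact (mem_lower.1 h).1.symm

/-- Translates deletion of one element into membership vectors on `S` that differ in exactly one
coordinate, the adjacency of the hypercube. -/
theorem exists_eq_erase_iff {α : Type*} [DecidableEq α] {S A B : Finset α} (hA : A ⊆ S)
    (hB : B ⊆ S) : ((∃ c ∈ A, B = A.erase c) ∨ ∃ c ∈ B, A = B.erase c) ↔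
      ∃ s ∈ S, ∀ t ∈ S, ¬ (t ∈ A ↔ t ∈ B) ↔ t = s := by
  constructor
  · rintro (⟨c, hc, rfl⟩ | ⟨c, hc, rfl⟩)
    · refine ⟨c, hA hc, fun t _ => ?_⟩
      rw [Finset.mem_erase]
      grind
    · refine ⟨c, hB hc, fun t _ => ?_⟩
      rw [Finset.mem_erase]
      grind
  · rintro ⟨s, hs, h⟩
    by_cases hsA : s ∈ A
    · refine Or.inl ⟨s, hsA, ?_⟩
      ext t
      rw [Finset.mem_erase]
      have := h t
      have := h s hs
      have := @hA t
      have := @hB t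
      grind
    · have hsB : s ∈ B := by
        have := h s hs
        grind
      refine Or.inr ⟨s, hsB, ?_⟩
      ext t
      rw [Finset.mem_erase]
      have := h t
      have := h s hs
      have := @hA t
      have := @hB t
      grind

theorem IsSharp.nonempty_iso_hypercube (hG : IsSharp G D D) : Nonempty (G ≃g hypercube D) := by
  obtain ⟨a, b, hab⟩ := hG.exists_dist_eq
  have hcard : (G.neighborFinset a).card = D := by
    rw [SimpleGraph.card_neighborFinset_eq_degree, hG.regular.degree_eq]
  let e : G.neighborFinset a ≃ Fin D := Finset.equivFinOfCardEq hcard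
  let Φ : V → Fin D → Bool := fun x i => decide ((e.symm i : V) ∈ label G a x)
  have hΦ : ∀ x i, Φ x i = true ↔ (e.symm i : V) ∈ label G a x := fun x i => decide_eq_true_iff
  have hinj : Function.Injective Φ := by
    intro x y h
    refine hG.label_injective hab ?_
    ext s
    by_cases hs : s ∈ G.neighborFinset a
    · have hx := hΦ x (e ⟨s, hs⟩)
      have hy := hΦ y (e ⟨s, hs⟩)
      rw [Equiv.symm_apply_apply] at hx hy
      rw [← hx, ← hy, h]
    · exact iff_of_false (fun h => hs (label_subset_neighborFinset a x h))
        (fun h => hs (label_subset_neighborFinset a y h))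
  have hsurj : Function.Surjective Φ := by
    intro g
    obtain ⟨x, hx⟩ := hG.exists_label_eq hab
      ((Finset.univ.filter fun i => g i = true).image fun i => (e.symm i : V)) (by
        intro s hs
        obtain ⟨i, -, rfl⟩ := Finset.mem_image.1 hs
        exact (e.symm i).2)
    refine ⟨x, funext fun i => ?_⟩
    rw [Bool.eq_iff_iff, hΦ, hx, Finset.mem_image]
    constructor
    · rintro ⟨j, hj, hji⟩
      rw [← e.symm.injective (Subtype.ext hji)]
      exact (Finset.mem_filter.1 hj).2
    · exact fun h => ⟨i, Finset.mem_filter.2 ⟨Finset.mem_univ _, h⟩, rfl⟩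
  refine ⟨⟨Equiv.ofBijective Φ ⟨hinj, hsurj⟩, fun {x y} => ?_⟩⟩
  rw [hG.adj_iff_mem_lower hab, hG.mem_lower_iff_label hab, hG.mem_lower_iff_label hab,
    exists_eq_erase_iff (label_subset_neighborFinset a x) (label_subset_neighborFinset a y)]
  change (Finset.univ.filter fun i => Φ x i ≠ Φ y i).card = 1 ↔ _
  rw [Finset.card_eq_one]
  have hne : ∀ i, Φ x i ≠ Φ y i ↔
      ¬ ((e.symm i : V) ∈ label G a x ↔ (e.symm i : V) ∈ label G a y) := fun i => by
    rw [← hΦ, ← hΦ, ← Bool.eq_iff_iff]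
  constructor
  · rintro ⟨i, hi⟩
    refine ⟨e.symm i, (e.symm i).2, fun t ht => ?_⟩
    have h1 := Finset.ext_iff.1 hi (e ⟨t, ht⟩)
    rw [Finset.mem_filter_univ, Finset.mem_singleton, hne, Equiv.symm_apply_apply] at h1
    rw [h1, ← Equiv.eq_symm_apply, Subtype.ext_iff]
  · rintro ⟨s, hs, h⟩
    refine ⟨e ⟨s, hs⟩, ?_⟩
    ext i
    rw [Finset.mem_filter_univ, Finset.mem_singleton, hne, h _ (e.symm i).2,
      ← Equiv.symm_apply_eq, Subtype.ext_iff]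

end Labels
end BonnetMyers

theorem mainTheorem11 {V : Type*} [Fintype V] [DecidableEq V] (G : SimpleGraph V)
    [DecidableRel G.Adj] (D L : ℕ) (hG : BonnetMyers.IsSharp G D L) (hL : L = D) :
    Nonempty (G ≃g BonnetMyers.hypercube D) := by
  subst hL
  exact hG.nonempty_iso_hypercube
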